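/- Let $J\subset\mathbb Z^2\setminus\{0\}$ be a finite set that is invariant under lattice rotations and reflections and generates $\mathbb Z^2$ as a group (for example, any such set containing the nearest-neighbour steps), and let $\beta\in(0,\infty)$. For a two-dimensional discrete torus $\Lambda$ of side length $n\ge 1$, the Discrete Gaussian model on $\Lambda$ is the probability measure on $\{\sigma\in(2\pi\mathbb Z)^{\Lambda}:\sigma_0=0\}$ with weights proportional to $e^{-\frac1{2\beta}(\sigma,-\Delta_J\sigma)}$, where $(\Delta_J f)(x)=\frac1{|J|}\sum_{y\in J}(f(x+y)-f(x))$. Extend $\sigma$ periodically to $\mathbb Z^2$, and let $\langle\cdot\rangle^{\Lambda}_{J,\beta}$ denote the law of its gradient field $\eta=(\eta_e)_{e\in E}$, $\eta_{(x,y)}=\sigma_x-\sigma_y$, indexed by the set $E$ of directed nearest-neighbour edges of $\mathbb Z^2$. Let $\mu=\langle\cdot\rangle^{\mathbb Z^2}_{J,\beta}$ be the infinite-volume gradient state, i.e. the weak limit (in the product topology on $\mathbb R^E$) of $\langle\cdot\rangle^{\Lambda_N}_{J,\beta}$ as $N\to\infty$, where $\Lambda_N$ has side length $2^N$; more generally,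 let $\mu$ be any probability measure that is the weak limit of $\langle\cdot\rangle^{\Lambda_{(k)}}_{J,\beta}$ along some sequence of tori $\Lambda_{(k)}$ whose side lengths tend to infinity. Then $\mu$ has tilt $0$, in the following sense. Let $\mu=\int\nu\,\rho(d\nu)$ be an ergodic decomposition of $\mu$, where $\rho$ is a probability measure on the space of measures on $\mathbb R^E$ and $\rho$-almost every $\nu$ is a probability measure that is invariant and ergodic under the translations of $\mathbb Z^2$. Then for $\rho$-almost every $\nu$ and every $e\in E$, the variable $\eta_e$ is $\nu$-integrable and $\int\eta_e\,d\nu=0$. -/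

import Mathlib

open Filter Topology MeasureTheory

namespace DiscreteGaussian

/-- The vertices of the square lattice. -/
abbrev Site : Type := ℤ × ℤ

/-- The directed nearest-neighbour edges `(x, y)` of the square lattice. -/
abbrev Edge : Type :=
  {e : Site × Site // |e.1.1 - e.2.1| + |e.1.2 - e.2.2| = 1}

/-- Real fields on the directed edges, with the product topology and product σ-algebra.
The gradient fields of height functions live in this space. -/
abbrev EdgeField : Type := Edge → ℝ

/-- The gradient field `η_e = σ_x - σ_y`, `e = (x, y)`, of a height function `σ`. -/
def gradient (σ : Site → ℝ) : EdgeField := fun e => σ e.1.1 - σ e.1.2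

/-- The edge `(x + a, y + a)`. -/
def Edge.translate (a : Site) (e : Edge) : Edge :=
  ⟨(e.1.1 + a, e.1.2 + a), by
    have h := e.2
    simpa [add_sub_add_right_eq_sub] using h⟩

/-- The action of lattice translations on edge fields. -/
def shift (a : Site) (η : EdgeField) : EdgeField := fun e => η (e.translate a)

/-- Finite-range step distributions: finite sets of nonzero lattice vectors, invariant under
lattice reflections and rotations, and irreducible (they generate the lattice). -/
structure IsStepDistribution (J : Finset Site) : Prop where
  zero_notMem : (0 : Site) ∉ J
  reflect_mem : ∀ y ∈ J, ((-y.1, y.2) : Site) ∈ J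
  rotate_mem : ∀ y ∈ J, ((-y.2, y.1) : Site) ∈ J
  generates : AddSubgroup.closure (J : Set Site) = ⊤

/-- The two-dimensional discrete torus of side length `n`. -/
abbrev Torus (n : ℕ) : Type := ZMod n × ZMod n

/-- The projection of the lattice onto the torus. -/
def toTorus (n : ℕ) (x : Site) : Torus n := ((x.1 : ZMod n), (x.2 : ZMod n))

/-- Integer fields on the torus that vanish at the origin. Such a `φ` encodes the
`2πℤ`-valued height function `σ = 2πφ` with `σ_0 = 0`. -/
abbrev PinnedField (n : ℕ) : Type := {φ : Torus n → ℤ // φ 0 = 0}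

/-- The `2πℤ`-valued height function on the torus encoded by `φ`. -/
noncomputable def height {n : ℕ} (φ : PinnedField n) (x : Torus n) : ℝ :=
  2 * Real.pi * (φ.1 x : ℝ)

/-- The Dirichlet form `(σ, -Δ_J σ)` on the torus, where
`(Δ_J σ)(x) = |J|⁻¹ ∑_{y ∈ J} (σ(x + y) - σ(x))`. -/
noncomputable def dirichletForm (J : Finset Site) (n : ℕ) [NeZero n] (σ : Torus n → ℝ) : ℝ :=
  ∑ x : Torus n, σ x * -((J.card : ℝ)⁻¹ * ∑ y ∈ J, (σ (x + toTorus n y) - σ x))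

/-- The Boltzmann weight `exp (-(σ, -Δ_J σ) / (2β))`. -/
noncomputable def weight (J : Finset Site) (β : ℝ) (n : ℕ) [NeZero n]
    (φ : PinnedField n) : ℝ :=
  Real.exp (-(1 / (2 * β)) * dirichletForm J n (height φ))

/-- The partition function of the Discrete Gaussian model on the torus. -/
noncomputable def partitionFunction (J : Finset Site) (β : ℝ) (n : ℕ) [NeZero n] : ENNReal :=
  ∑' φ : PinnedField n, ENNReal.ofReal (weight J β n φ)

/-- The law of the gradient field (extended periodically to the square lattice) of the
Discrete Gaussian model at temperature `β` on the torus of side length `n`. -/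
noncomputable def torusState (J : Finset Site) (β : ℝ) (n : ℕ) [NeZero n] :
    Measure EdgeField :=
  (partitionFunction J β n)⁻¹ •
    Measure.sum fun φ : PinnedField n =>
      ENNReal.ofReal (weight J β n φ) •
        Measure.dirac (gradient fun x => height φ (toTorus n x))

/-- `μ` is the weak limit, as gradient fields, of the Discrete Gaussian states on the tori of
side lengths `M 0, M 1, M 2, …`. -/
def IsTorusLimit (J : Finset Site) (β : ℝ) (M : ℕ → ℕ) [∀ k, NeZero (M k)]
    (μ : Measure EdgeField) : Prop :=
  IsProbabilityMeasure μ ∧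
    ∀ F : BoundedContinuousFunction EdgeField ℝ,
      Tendsto (fun k => ∫ η, F η ∂(torusState J β (M k))) atTop (𝓝 (∫ η, F η ∂μ))

/-- `ν` is a probability measure, invariant and ergodic under lattice translations. -/
structure IsErgodicMeasure (ν : Measure EdgeField) : Prop where
  isProbabilityMeasure : IsProbabilityMeasure ν
  invariant : ∀ a : Site, MeasurePreserving (shift a) ν ν
  ergodic : ∀ A : Set EdgeField, MeasurableSet A → (∀ a : Site, shift a ⁻¹' A = A) →
    ν A = 0 ∨ ν A = 1

/-- `ρ` is an ergodic decomposition of `μ`: a probability measure on the space of measures,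
carried by the ergodic ones, whose barycentre is `μ`. -/
structure IsErgodicDecomposition (ρ : Measure (Measure EdgeField)) (μ : Measure EdgeField) :
    Prop where
  isProbabilityMeasure : IsProbabilityMeasure ρ
  ergodic : ∀ᵐ ν ∂ρ, IsErgodicMeasure ν
  barycentre : ∀ A : Set EdgeField, MeasurableSet A → μ A = ∫⁻ ν, ν A ∂ρ

end DiscreteGaussian

open scoped ENNReal

namespace DiscreteGaussian

/-! The sum of `η` over the translates of an edge by an `m × m` box has second moment at most `C
m²`, uniformly in tori of side at least `m`. A component of tilt `u` would give it second moment at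
least `u² m⁴`. Since second moments average over the ergodic decomposition, the mean of `u²` is at
most `C / m²` for every `m`, hence zero. The `m²` bound is a comparison with the real-valued
Gaussian field and needs no correlation decay. For a quadratic `Q` on a lattice `L`, rotate two
independent copies to `(x + y, x - y)`. The image consists of the pairs congruent modulo `2L`, and
Cauchy–Schwarz over these cosets gives `theta_pow_four_le`: tilting by `l` costs no more than the
fourth root of tilting by `2 l`. Iterating turns a crude bound with a bad prefactor into the
sub-Gaussian bound `theta_le`, whose prefactor is one. `sq_boxSum_gradient_le` and
`exists_incrementEnergy_le` then bound box sums by the energy. -/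

theorem sq_tsum_mul_le {ι : Type*} (A B : ι → ℝ≥0∞) :
    (∑' i, A i * B i) ^ 2 ≤ (∑' i, A i ^ 2) * ∑' i, B i ^ 2 := by
  let _ : MeasurableSpace ι := ⊤
  have h := ENNReal.lintegral_mul_le_Lp_mul_Lq (Measure.count : Measure ι)
    Real.HolderConjugate.two_two (f := A) (g := B) measurable_from_top.aemeasurable
    measurable_from_top.aemeasurable
  rw [lintegral_count, lintegral_count, lintegral_count] at h
  simp only [Pi.mul_apply, ENNReal.rpow_two] at h
  calc (∑' i, A i * B i) ^ 2
      ≤ ((∑' i, A i ^ 2) ^ (1 / 2 : ℝ) * (∑' i, B i ^ 2) ^ (1 / 2 : ℝ)) ^ 2 := by gcongr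
    _ = _ := by
      rw [mul_pow, ← ENNReal.rpow_two, ← ENNReal.rpow_two, ← ENNReal.rpow_mul,
        ← ENNReal.rpow_mul]
      norm_num

/-! ### Theta series on a lattice and the sub-Gaussian bound. -/

section Lattice

variable {L : Type*} [AddCommGroup L]

/-- The subgroup of doubles of elements of `L`. -/
def doubles (L : Type*) [AddCommGroup L] : AddSubgroup L :=
  (nsmulAddMonoidHom (α := L) 2).range

theorem add_self_mem_doubles (x : L) : x + x ∈ doubles L := ⟨x, by simp [two_nsmul]⟩

theorem bijective_out_add_double (hL : Function.Injective fun x : L => x + x) :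
    Function.Bijective fun p : (L ⧸ doubles L) × L => p.1.out + (p.2 + p.2) := by
  have hmk : ∀ p : (L ⧸ doubles L) × L,
      ((p.1.out + (p.2 + p.2) : L) : L ⧸ doubles L) = p.1 := fun p => by
    rw [QuotientAddGroup.mk_add, QuotientAddGroup.out_eq',
      (QuotientAddGroup.eq_zero_iff _).2 (add_self_mem_doubles p.2), add_zero]
  constructor
  · intro p q h
    have h1 : p.1 = q.1 := by rw [← hmk p, ← hmk q]; exact congrArg _ h
    refine Prod.ext h1 (hL ?_)
    simpa [h1] using h
  · intro x
    have hx : -(x : L ⧸ doubles L).out + x ∈ doubles L :=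
      QuotientAddGroup.eq.1 (QuotientAddGroup.out_eq' _)
    obtain ⟨y, hy⟩ := hx
    refine ⟨((x : L ⧸ doubles L), y), ?_⟩
    have : y + y = -(x : L ⧸ doubles L).out + x := by rw [← hy]; simp [two_nsmul]
    simp [this]

theorem tsum_eq_tsum_doubles_cosets (hL : Function.Injective fun x : L => x + x)
    (f : L → ℝ≥0∞) :
    ∑' x, f x = ∑' c : L ⧸ doubles L, ∑' y : L, f (c.out + (y + y)) := by
  rw [← (Equiv.ofBijective _ (bijective_out_add_double hL)).tsum_eq f, ENNReal.tsum_prod']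
  rfl

/-- The sum and difference of two lattice points agree modulo doubles, and any two congruent points
arise this way, so within each coset the sum factorizes. -/
theorem tsum_add_sub_eq (hL : Function.Injective fun x : L => x + x) (a b : L → ℝ≥0∞) :
    ∑' x : L, ∑' y : L, a (x + y) * b (x - y) =
      ∑' c : L ⧸ doubles L,
        (∑' y, a (c.out + (y + y))) * ∑' y, b (c.out + (y + y)) := by
  -- Substitute `d = x - y`, so that `x + y = d + 2y`.
  have h1 : ∀ y : L, ∑' x : L, a (x + y) * b (x - y) = ∑' d : L, a (d + (y + y)) * b d := by
    intro y
    rw [← (Equiv.addRight y).tsum_eq]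
    simp [add_assoc]
  rw [ENNReal.tsum_comm]
  simp_rw [h1]
  rw [ENNReal.tsum_comm]
  simp_rw [ENNReal.tsum_mul_right]
  rw [tsum_eq_tsum_doubles_cosets hL]
  refine tsum_congr fun c => ?_
  -- The inner sum depends on `d = c + 2z` only through its coset.
  have h2 : ∀ z : L, ∑' y, a (c.out + (z + z) + (y + y)) = ∑' y, a (c.out + (y + y)) := by
    intro z
    rw [← (Equiv.addLeft z).tsum_eq fun y => a (c.out + (y + y))]
    refine tsum_congr fun y => ?_
    simp only [Equiv.coe_addLeft]
    congr 1
    abel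
  simp_rw [h2]
  rw [ENNReal.tsum_mul_left]

theorem sq_tsum_add_sub_le (hL : Function.Injective fun x : L => x + x) (a b : L → ℝ≥0∞) :
    (∑' x : L, ∑' y : L, a (x + y) * b (x - y)) ^ 2 ≤
      (∑' x : L, ∑' y : L, a (x + y) * a (x - y)) *
        ∑' x : L, ∑' y : L, b (x + y) * b (x - y) := by
  rw [tsum_add_sub_eq hL, tsum_add_sub_eq hL, tsum_add_sub_eq hL]
  simp_rw [← pow_two]
  exact sq_tsum_mul_le _ _

/-- The theta series `∑ exp (-Q + ℓ)`. -/
noncomputable def theta (Q : L → ℝ) (l : L → ℝ) : ℝ≥0∞ :=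
  ∑' x, ENNReal.ofReal (Real.exp (-Q x + l x))

variable {Q : L → ℝ}

/-- By the parallelogram law, linear terms `l₁`, `l₂` on the rotated copies become `l₁ + l₂` and `l₁
- l₂` on the original ones. The three sums in `sq_tsum_add_sub_le` come from `(l, 0)`, `(l, l)` and
`(0, 0)`. -/
theorem theta_pow_four_le (hL : Function.Injective fun x : L => x + x)
    (hQ : ∀ x y, Q (x + y) + Q (x - y) = 2 * Q x + 2 * Q y) (l : L →+ ℝ) :
    theta Q l ^ 4 ≤ theta Q ((2 : ℝ) • ⇑l) * theta Q 0 ^ 3 := by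
  have key : ∀ l₁ l₂ : L →+ ℝ,
      ∑' x : L, ∑' y : L, ENNReal.ofReal (Real.exp (-(Q (x + y) / 2) + l₁ (x + y))) *
        ENNReal.ofReal (Real.exp (-(Q (x - y) / 2) + l₂ (x - y))) =
      theta Q (l₁ + l₂) * theta Q (l₁ - l₂) := by
    intro l₁ l₂
    rw [theta, theta, ← ENNReal.tsum_mul_right]
    refine tsum_congr fun x => ?_
    rw [← ENNReal.tsum_mul_left]
    refine tsum_congr fun y => ?_
    rw [← ENNReal.ofReal_mul (Real.exp_pos _).le, ← ENNReal.ofReal_mul (Real.exp_pos _).le,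
      ← Real.exp_add, ← Real.exp_add]
    congr 2
    have := hQ x y
    simp only [map_add, map_sub, Pi.add_apply, Pi.sub_apply]
    linarith
  have h := sq_tsum_add_sub_le hL
    (fun x => ENNReal.ofReal (Real.exp (-(Q x / 2) + l x)))
    (fun x => ENNReal.ofReal (Real.exp (-(Q x / 2) + (0 : L →+ ℝ) x)))
  rw [key, key, key] at h
  rw [show ⇑(0 : L →+ ℝ) = 0 from rfl] at h
  simp only [add_zero, sub_zero, sub_self, ← two_smul ℝ (⇑l)] at h
  calc theta Q l ^ 4 = (theta Q l * theta Q l) ^ 2 := by ring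
    _ ≤ _ := h
    _ = _ := by ring

theorem le_of_forall_pow_le {y K : ℝ} (h : ∀ k : ℕ, y ^ 4 ^ k ≤ K) : y ≤ 1 := by
  by_contra! hy
  obtain ⟨n, hn⟩ := pow_unbounded_of_one_lt K hy
  have h1 : n ≤ 4 ^ n := (Nat.lt_pow_self (by norm_num)).le
  exact absurd (h n) (not_le.2 (hn.trans_le (pow_le_pow_right₀ hy.le h1)))

/-- Sub-Gaussian bound for integer lattice fields. -/
theorem theta_le (hL : Function.Injective fun x : L => x + x)
    (hQ : ∀ x y, Q (x + y) + Q (x - y) = 2 * Q x + 2 * Q y)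
    (hsum : ∑' x, ENNReal.ofReal (Real.exp (-(Q x / 2))) ≠ ∞)
    {D : ℝ} (hD : 0 < D) (l : L →+ ℝ) (hl : ∀ x, l x ^ 2 ≤ D * Q x) :
    theta Q l ≤ ENNReal.ofReal (Real.exp (D / 2)) * theta Q 0 := by
  have hQ0 : ∀ x, 0 ≤ Q x := fun x => by
    have := (sq_nonneg _).trans (hl x)
    exact nonneg_of_mul_nonneg_right this hD
  set S := ∑' x, ENNReal.ofReal (Real.exp (-(Q x / 2))) with hS
  -- Half of `Q` is spent on absorbing `m`, since `m ≤ (E + Q) / 2`; the price is the prefactor `S`.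
  have hcrude : ∀ (E : ℝ) (m : L → ℝ), 0 < E → (∀ x, m x ^ 2 ≤ E * Q x) →
      theta Q m ≤ ENNReal.ofReal (Real.exp (E / 2)) * S := by
    intro E m hE hm
    rw [hS, theta, ← ENNReal.tsum_mul_left]
    refine ENNReal.tsum_le_tsum fun x => ?_
    rw [← ENNReal.ofReal_mul (Real.exp_pos _).le, ← Real.exp_add]
    refine ENNReal.ofReal_le_ofReal (Real.exp_le_exp.2 ?_)
    have h2 : m x ≤ (E + Q x) / 2 := by
      refine le_of_sq_le_sq ?_ (by have := hQ0 x; positivity)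
      nlinarith [hm x, sq_nonneg (E - Q x)]
    linarith
  have hfin : ∀ (E : ℝ) (m : L → ℝ), 0 < E → (∀ x, m x ^ 2 ≤ E * Q x) → theta Q m ≠ ∞ :=
    fun E m hE hm => ne_top_of_le_ne_top (ENNReal.mul_ne_top ENNReal.ofReal_ne_top hsum)
      (hcrude E m hE hm)
  have h0fin : theta Q 0 ≠ ∞ :=
    hfin D 0 hD fun x => by simpa using mul_nonneg hD.le (hQ0 x)
  have h0pos : theta Q 0 ≠ 0 := by
    intro h
    have := ENNReal.tsum_eq_zero.1 h 0
    simp [not_le.2 (Real.exp_pos _)] at this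
  have ht0 : 0 < (theta Q 0).toReal := ENNReal.toReal_pos h0pos h0fin
  set r : (L → ℝ) → ℝ := fun m => (theta Q m).toReal / (theta Q 0).toReal with hr
  have hr0 : ∀ m, 0 ≤ r m := fun m => by positivity
  have hscale : ∀ k : ℕ, ∀ x, ((2 ^ k : ℝ) • ⇑l) x ^ 2 ≤ (4 ^ k * D) * Q x := by
    intro k x
    have h4 : ((4 : ℝ) ^ k) = (2 ^ k) ^ 2 := by
      rw [← pow_mul, mul_comm, pow_mul]; norm_num
    have : ((2 ^ k : ℝ) • ⇑l) x = 2 ^ k * l x := rfl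
    rw [this, mul_pow, h4, mul_assoc]
    exact mul_le_mul_of_nonneg_left (hl x) (by positivity)
  have hstep : ∀ k : ℕ, r ((2 ^ k : ℝ) • ⇑l) ^ 4 ≤ r ((2 ^ (k + 1) : ℝ) • ⇑l) := by
    intro k
    have h := theta_pow_four_le hL hQ ((AddMonoidHom.mulLeft (2 ^ k : ℝ)).comp l)
    have e1 : ⇑((AddMonoidHom.mulLeft (2 ^ k : ℝ)).comp l) = (2 ^ k : ℝ) • ⇑l := rfl
    rw [e1, smul_smul, ← pow_succ'] at h
    have hf := hfin _ _ (by positivity) (hscale (k + 1))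
    have h' := ENNReal.toReal_mono (ENNReal.mul_ne_top hf (ENNReal.pow_ne_top h0fin)) h
    rw [ENNReal.toReal_mul, ENNReal.toReal_pow, ENNReal.toReal_pow] at h'
    simp only [hr]
    rw [div_pow, div_le_div_iff₀ (by positivity) ht0]
    calc _ ≤ ((theta Q ((2 ^ (k + 1) : ℝ) • ⇑l)).toReal * (theta Q 0).toReal ^ 3) *
          (theta Q 0).toReal := by gcongr
      _ = _ := by ring
  have hiter : ∀ k : ℕ, r l ^ 4 ^ k ≤ r ((2 ^ k : ℝ) • ⇑l) := by
    intro k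
    induction k with
    | zero => simp
    | succ k ih =>
      rw [pow_succ, pow_mul]
      exact (pow_le_pow_left₀ (pow_nonneg (hr0 _) _) ih 4).trans (hstep k)
  -- Replacing `l` by `2 ^ k • l` multiplies `D` by `4 ^ k`, exactly the power produced by
  -- iteration. The prefactor does not depend on `k`, so it disappears in the `4 ^ k`-th root.
  have hbd : ∀ k : ℕ, (r l / Real.exp (D / 2)) ^ 4 ^ k ≤ S.toReal / (theta Q 0).toReal := by
    intro k
    have h1 := ENNReal.toReal_mono (ENNReal.mul_ne_top ENNReal.ofReal_ne_top hsum)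
      (hcrude _ _ (by positivity) (hscale k))
    rw [ENNReal.toReal_mul, ENNReal.toReal_ofReal (Real.exp_pos _).le] at h1
    have h2 : Real.exp (4 ^ k * D / 2) = Real.exp (D / 2) ^ 4 ^ k := by
      rw [← Real.exp_nat_mul]; push_cast; ring_nf
    rw [div_pow, div_le_iff₀ (by positivity), ← h2]
    refine (hiter k).trans ?_
    simp only [hr]
    rw [div_mul_eq_mul_div, mul_comm S.toReal]
    gcongr
  have h1 := le_of_forall_pow_le hbd
  rw [div_le_one (Real.exp_pos _), hr, div_le_iff₀ ht0] at h1
  rw [← ENNReal.ofReal_toReal (hfin D l hD hl), ← ENNReal.ofReal_toReal h0fin,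
    ← ENNReal.ofReal_mul (Real.exp_pos _).le]
  exact ENNReal.ofReal_le_ofReal h1

theorem sq_le_exp_add_exp (x : ℝ) : x ^ 2 ≤ 2 * (Real.exp x + Real.exp (-x)) := by
  have h := Real.quadratic_le_exp_of_nonneg (abs_nonneg x)
  rw [sq_abs] at h
  have h3 := abs_nonneg x
  rcases abs_choice x with h2 | h2 <;> rw [h2] at h h3 <;>
    nlinarith [Real.exp_pos x, Real.exp_pos (-x)]

/-- Second moment bound for integer lattice fields. -/
theorem tsum_sq_mul_exp_le (hL : Function.Injective fun x : L => x + x)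
    (hQ : ∀ x y, Q (x + y) + Q (x - y) = 2 * Q x + 2 * Q y)
    (hsum : ∑' x, ENNReal.ofReal (Real.exp (-(Q x / 2))) ≠ ∞)
    {D : ℝ} (hD : 0 < D) (l : L →+ ℝ) (hl : ∀ x, l x ^ 2 ≤ D * Q x) :
    ∑' x, ENNReal.ofReal (Real.exp (-Q x)) * ENNReal.ofReal (l x ^ 2) ≤
      ENNReal.ofReal (4 * Real.exp (1 / 2) * D) * theta Q 0 := by
  have hsq : √D ^ 2 = D := Real.sq_sqrt hD.le
  -- Normalizing `l` by `√D` keeps the exponential factor constant, so the second moment is linear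
  -- in `D`.
  have hb : ∀ c : ℝ, c ^ 2 = 1 / D → theta Q (c • ⇑l) ≤
      ENNReal.ofReal (Real.exp (1 / 2)) * theta Q 0 := by
    intro c hc
    refine theta_le hL hQ hsum one_pos ((AddMonoidHom.mulLeft c).comp l) fun x => ?_
    have : ((AddMonoidHom.mulLeft c).comp l) x = c * l x := rfl
    rw [this, mul_pow, hc, one_mul, div_mul_eq_mul_div, one_mul, div_le_iff₀ hD, mul_comm]
    exact hl x
  have h1 := hb (1 / √D) (by rw [div_pow, hsq, one_pow])
  have h2 := hb (-(1 / √D)) (by rw [neg_sq, div_pow, hsq, one_pow])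
  calc ∑' x, ENNReal.ofReal (Real.exp (-Q x)) * ENNReal.ofReal (l x ^ 2)
      ≤ ∑' x, ENNReal.ofReal (2 * D) *
        (ENNReal.ofReal (Real.exp (-Q x + ((1 / √D) • ⇑l) x)) +
          ENNReal.ofReal (Real.exp (-Q x + (-(1 / √D) • ⇑l) x))) := by
        refine ENNReal.tsum_le_tsum fun x => ?_
        rw [← ENNReal.ofReal_add (Real.exp_pos _).le (Real.exp_pos _).le,
          ← ENNReal.ofReal_mul (by positivity), ← ENNReal.ofReal_mul (by positivity)]
        refine ENNReal.ofReal_le_ofReal ?_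
        have h3 := sq_le_exp_add_exp (1 / √D * l x)
        rw [mul_pow, div_pow, hsq, one_pow, one_div_mul_eq_div, div_le_iff₀ hD] at h3
        simp only [Pi.smul_apply, smul_eq_mul, Real.exp_add, neg_mul]
        calc _ ≤ Real.exp (-Q x) * _ := mul_le_mul_of_nonneg_left h3 (Real.exp_pos _).le
          _ = _ := by ring
    _ = ENNReal.ofReal (2 * D) * (theta Q ((1 / √D) • ⇑l) + theta Q (-(1 / √D) • ⇑l)) := by
        rw [ENNReal.tsum_mul_left, ENNReal.tsum_add]; rfl
    _ ≤ ENNReal.ofReal (2 * D) * (ENNReal.ofReal (Real.exp (1 / 2)) * theta Q 0 +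
          ENNReal.ofReal (Real.exp (1 / 2)) * theta Q 0) := by gcongr
    _ = _ := by
        rw [← two_mul, show (4 * Real.exp (1 / 2) * D) = (2 * D) * (2 * Real.exp (1 / 2)) by ring,
          ENNReal.ofReal_mul (p := 2 * D) (by positivity),
          ENNReal.ofReal_mul (p := 2) (q := Real.exp _) (by positivity)]
        simp only [ENNReal.ofReal_ofNat]
        ring

end Lattice

/-! ### Convergence of Gaussian sums over integer vectors. -/

section Summability

theorem tsum_fin_pi_prod {α : Type*} (g : α → ℝ≥0∞) (k : ℕ) :
    ∑' f : Fin k → α, ∏ i, g (f i) = (∑' a, g a) ^ k := by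
  induction k with
  | zero => simp [tsum_fintype]
  | succ k ih =>
    rw [← (Fin.consEquiv fun _ : Fin (k + 1) => α).tsum_eq, ENNReal.tsum_prod', pow_succ', ← ih,
      ← ENNReal.tsum_mul_right]
    refine tsum_congr fun a => ?_
    rw [← ENNReal.tsum_mul_left]
    refine tsum_congr fun f => ?_
    simp [Fin.consEquiv, Fin.prod_univ_succ]

theorem tsum_pi_prod {ι α : Type*} [Fintype ι] (g : α → ℝ≥0∞) :
    ∑' f : ι → α, ∏ i, g (f i) = (∑' a, g a) ^ Fintype.card ι := by
  rw [← tsum_fin_pi_prod, ← ((Fintype.equivFin ι).arrowCongr (Equiv.refl α)).tsum_eq]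
  refine tsum_congr fun f => ?_
  rw [← (Fintype.equivFin ι).prod_comp]
  simp

theorem tsum_int_exp_neg_sq_ne_top {c : ℝ} (hc : 0 < c) :
    ∑' z : ℤ, ENNReal.ofReal (Real.exp (-(c * (z : ℝ) ^ 2))) ≠ ∞ := by
  have hs : Summable fun z : ℤ => Real.exp (-(c * (z : ℝ) ^ 2)) := by
    have hN : Summable fun k : ℕ => Real.exp (-(c * (k : ℝ) ^ 2)) := by
      refine (Real.summable_exp_nat_mul_iff.2 (neg_lt_zero.2 hc)).of_nonneg_of_le
        (fun _ => (Real.exp_pos _).le) fun k => Real.exp_le_exp.2 ?_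
      have : (k : ℝ) ≤ (k : ℝ) ^ 2 := by exact_mod_cast Nat.le_self_pow two_ne_zero k
      nlinarith
    exact Summable.of_nat_of_neg (by simpa using hN) (by simpa using hN)
  rw [← ENNReal.ofReal_tsum_of_nonneg (fun _ => (Real.exp_pos _).le) hs]
  exact ENNReal.ofReal_ne_top

theorem tsum_pi_exp_neg_sum_sq_ne_top {ι : Type*} [Fintype ι] {c : ℝ} (hc : 0 < c) :
    ∑' f : ι → ℤ, ENNReal.ofReal (Real.exp (-(c * ∑ i, (f i : ℝ) ^ 2))) ≠ ∞ := by
  have : ∀ f : ι → ℤ, ENNReal.ofReal (Real.exp (-(c * ∑ i, (f i : ℝ) ^ 2))) =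
      ∏ i, ENNReal.ofReal (Real.exp (-(c * (f i : ℝ) ^ 2))) := by
    intro f
    rw [← ENNReal.ofReal_prod_of_nonneg fun _ _ => (Real.exp_pos _).le, ← Real.exp_sum,
      Finset.mul_sum, Finset.sum_neg_distrib]
  simp_rw [this]
  rw [tsum_pi_prod (fun z : ℤ => ENNReal.ofReal (Real.exp (-(c * (z : ℝ) ^ 2))))]
  exact ENNReal.pow_ne_top (tsum_int_exp_neg_sq_ne_top hc)

end Summability

/-! ### Dirichlet form: increments and Poincaré inequality. -/

section Energy

variable (n : ℕ)

theorem toTorus_zero : toTorus n 0 = 0 := by simp [toTorus]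

theorem toTorus_add (a b : Site) : toTorus n (a + b) = toTorus n a + toTorus n b := by
  simp [toTorus]

theorem toTorus_neg (a : Site) : toTorus n (-a) = -toTorus n a := by
  simp [toTorus]

theorem toTorus_surjective : Function.Surjective (toTorus n) := by
  rintro ⟨x, y⟩
  obtain ⟨a, rfl⟩ := ZMod.intCast_surjective x
  obtain ⟨b, rfl⟩ := ZMod.intCast_surjective y
  exact ⟨(a, b), rfl⟩

variable [NeZero n]

/-- The sum over the torus of the squared increments of `h` in direction `a`. -/
noncomputable def incrementEnergy (a : Site) (h : Torus n → ℝ) : ℝ :=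
  ∑ x, (h (x + toTorus n a) - h x) ^ 2

variable {n}

theorem incrementEnergy_nonneg (a : Site) (h : Torus n → ℝ) : 0 ≤ incrementEnergy n a h :=
  Finset.sum_nonneg fun _ _ => sq_nonneg _

theorem incrementEnergy_zero (h : Torus n → ℝ) : incrementEnergy n 0 h = 0 := by
  simp [incrementEnergy, toTorus_zero]

theorem incrementEnergy_neg (a : Site) (h : Torus n → ℝ) :
    incrementEnergy n (-a) h = incrementEnergy n a h := by
  unfold incrementEnergy
  rw [← Equiv.sum_comp (Equiv.addRight (toTorus n a))]
  refine Finset.sum_congr rfl fun x _ => ?_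
  simp only [Equiv.coe_addRight, toTorus_neg, add_neg_cancel_right]
  ring

theorem incrementEnergy_add_le (a b : Site) (h : Torus n → ℝ) :
    incrementEnergy n (a + b) h ≤ 2 * incrementEnergy n a h + 2 * incrementEnergy n b h := by
  have h1 : incrementEnergy n b h =
      ∑ x, (h (x + toTorus n a + toTorus n b) - h (x + toTorus n a)) ^ 2 :=
    (Equiv.sum_comp (Equiv.addRight (toTorus n a)) fun x => (h (x + toTorus n b) - h x) ^ 2).symm
  rw [h1]
  unfold incrementEnergy
  rw [Finset.mul_sum, Finset.mul_sum, ← Finset.sum_add_distrib]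
  refine Finset.sum_le_sum fun x _ => ?_
  rw [toTorus_add, ← add_assoc]
  nlinarith [sq_nonneg (h (x + toTorus n a + toTorus n b) - h (x + toTorus n a) -
    (h (x + toTorus n a) - h x))]

/-- Summation by parts, one direction at a time: translation by `y` permutes the torus, so `h(x +
y)²` and `h(x)²` have the same sum. -/
theorem dirichletForm_eq (J : Finset Site) (h : Torus n → ℝ) :
    dirichletForm J n h = (2 * (J.card : ℝ))⁻¹ * ∑ y ∈ J, incrementEnergy n y h := by
  have h1 : ∀ y : Site,
      ∑ x, h x * (h (x + toTorus n y) - h x) = -(1 / 2) * incrementEnergy n y h := by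
    intro y
    have h2 : ∑ x, h (x + toTorus n y) ^ 2 = ∑ x, h x ^ 2 :=
      Equiv.sum_comp (Equiv.addRight (toTorus n y)) fun x => h x ^ 2
    have h3 : incrementEnergy n y h = ∑ x, h (x + toTorus n y) ^ 2 - ∑ x, h x ^ 2 -
        2 * ∑ x, h x * (h (x + toTorus n y) - h x) := by
      unfold incrementEnergy
      rw [Finset.mul_sum, ← Finset.sum_sub_distrib, ← Finset.sum_sub_distrib]
      exact Finset.sum_congr rfl fun x _ => by ring
    rw [h3, h2]
    ring
  unfold dirichletForm
  calc _ = -(J.card : ℝ)⁻¹ * ∑ x, ∑ y ∈ J, h x * (h (x + toTorus n y) - h x) := by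
        rw [Finset.mul_sum]
        refine Finset.sum_congr rfl fun x _ => ?_
        rw [← Finset.mul_sum]
        ring
    _ = _ := by
        rw [Finset.sum_comm, Finset.sum_congr rfl fun y _ => h1 y, ← Finset.mul_sum, mul_inv]
        ring

theorem dirichletForm_nonneg (J : Finset Site) (h : Torus n → ℝ) : 0 ≤ dirichletForm J n h := by
  rw [dirichletForm_eq]
  have := Finset.sum_nonneg fun y (_ : y ∈ J) => incrementEnergy_nonneg y h
  positivity

theorem dirichletForm_parallelogram (J : Finset Site) (g h : Torus n → ℝ) :
    dirichletForm J n (g + h) + dirichletForm J n (g - h) =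
      2 * dirichletForm J n g + 2 * dirichletForm J n h := by
  have : ∀ y, incrementEnergy n y (g + h) + incrementEnergy n y (g - h) =
      2 * incrementEnergy n y g + 2 * incrementEnergy n y h := by
    intro y
    unfold incrementEnergy
    rw [Finset.mul_sum, Finset.mul_sum, ← Finset.sum_add_distrib, ← Finset.sum_add_distrib]
    refine Finset.sum_congr rfl fun x _ => ?_
    simp only [Pi.add_apply, Pi.sub_apply]
    ring
  simp only [dirichletForm_eq]
  rw [← mul_add, ← Finset.sum_add_distrib, Finset.sum_congr rfl fun y _ => this y,
    Finset.sum_add_distrib, ← Finset.mul_sum, ← Finset.mul_sum]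
  ring

/-- Increments in any direction are controlled by the Dirichlet form, uniformly in the torus. -/
theorem exists_incrementEnergy_le {J : Finset Site} (hJ : IsStepDistribution J) (a : Site) :
    ∃ C : ℝ, 0 < C ∧ ∀ (n : ℕ) [NeZero n] (h : Torus n → ℝ),
      incrementEnergy n a h ≤ C * dirichletForm J n h := by
  have ha : a ∈ AddSubgroup.closure (J : Set Site) := by rw [hJ.generates]; trivial
  -- The constant is read off an expression of `a` through elements of `J`, so it does not involve
  -- the torus.
  induction ha using AddSubgroup.closure_induction with
  | mem y hy =>
    have hy : y ∈ J := hy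
    have hcard : (0 : ℝ) < J.card := by exact_mod_cast Finset.card_pos.2 ⟨y, hy⟩
    refine ⟨2 * J.card, by positivity, fun n _ h => ?_⟩
    rw [dirichletForm_eq, mul_inv_cancel_left₀ (by positivity)]
    exact Finset.single_le_sum (fun z _ => incrementEnergy_nonneg z h) hy
  | zero =>
    refine ⟨1, one_pos, fun n _ h => ?_⟩
    rw [incrementEnergy_zero, one_mul]
    exact dirichletForm_nonneg J h
  | add a b _ _ iha ihb =>
    obtain ⟨A, hA, hA'⟩ := iha
    obtain ⟨B, hB, hB'⟩ := ihb
    refine ⟨2 * A + 2 * B, by positivity, fun n _ h => ?_⟩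
    have := incrementEnergy_add_le a b h
    have := hA' n h
    have := hB' n h
    linarith
  | neg a _ ih =>
    obtain ⟨A, hA, hA'⟩ := ih
    exact ⟨A, hA, fun n _ h => by rw [incrementEnergy_neg]; exact hA' n h⟩

/-- Poincaré inequality for functions vanishing at the origin. -/
theorem exists_sum_sq_le_dirichletForm {J : Finset Site} (hJ : IsStepDistribution J) (n : ℕ)
    [NeZero n] : ∃ C : ℝ, 0 < C ∧ ∀ h : Torus n → ℝ, h 0 = 0 →
      ∑ x, h x ^ 2 ≤ C * dirichletForm J n h := by
  have hx : ∀ x : Torus n, ∃ C : ℝ, 0 < C ∧ ∀ h : Torus n → ℝ, h 0 = 0 →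
      h x ^ 2 ≤ C * dirichletForm J n h := by
    intro x
    obtain ⟨a, rfl⟩ := toTorus_surjective n x
    obtain ⟨C, hC, hC'⟩ := exists_incrementEnergy_le hJ a
    refine ⟨C, hC, fun h h0 => le_trans ?_ (hC' n h)⟩
    have := Finset.single_le_sum (f := fun x => (h (x + toTorus n a) - h x) ^ 2)
      (fun x _ => sq_nonneg _) (Finset.mem_univ (0 : Torus n))
    simpa [h0, incrementEnergy] using this
  choose C hC hC' using hx
  refine ⟨∑ x, C x, Finset.sum_pos (fun x _ => hC x) Finset.univ_nonempty, fun h h0 => ?_⟩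
  rw [Finset.sum_mul]
  exact Finset.sum_le_sum fun x _ => hC' x h h0

end Energy

/-! ### Second moments in the torus model. -/

section TorusModel

/-- Integer fields vanishing at the origin, as a subgroup of all integer fields. -/
def pinnedSubgroup (n : ℕ) : AddSubgroup (Torus n → ℤ) where
  carrier := {φ | φ 0 = 0}
  add_mem' := fun {a b} ha hb => by
    simp only [Set.mem_ofPred_eq, Pi.add_apply] at *
    rw [ha, hb, add_zero]
  zero_mem' := rfl
  neg_mem' := fun {a} ha => by
    simp only [Set.mem_ofPred_eq, Pi.neg_apply] at *
    rw [ha, neg_zero]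

instance (n : ℕ) : AddCommGroup (PinnedField n) :=
  inferInstanceAs (AddCommGroup (pinnedSubgroup n))

variable {n : ℕ}

theorem height_add (φ ψ : PinnedField n) : height (φ + ψ) = height φ + height ψ := by
  funext x
  have : (φ + ψ).1 x = φ.1 x + ψ.1 x := rfl
  simp [height, this, mul_add]

theorem height_neg (φ : PinnedField n) : height (-φ) = -height φ := by
  funext x
  have : (-φ).1 x = -φ.1 x := rfl
  simp [height, this]

theorem height_sub (φ ψ : PinnedField n) : height (φ - ψ) = height φ - height ψ := by
  rw [sub_eq_add_neg, height_add, height_neg, sub_eq_add_neg]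

theorem injective_add_self_pinnedField :
    Function.Injective fun φ : PinnedField n => φ + φ := by
  intro φ ψ h
  refine Subtype.ext (funext fun x => ?_)
  have h1 : φ.1 x + φ.1 x = ψ.1 x + ψ.1 x :=
    congrFun (congrArg (fun χ : PinnedField n => χ.1) h) x
  omega

variable [NeZero n]

/-- The energy of an integer field. -/
noncomputable def energy (J : Finset Site) (β : ℝ) (φ : PinnedField n) : ℝ :=
  1 / (2 * β) * dirichletForm J n (height φ)

theorem energy_parallelogram (J : Finset Site) (β : ℝ) (φ ψ : PinnedField n) :
    energy J β (φ + ψ) + energy J β (φ - ψ) = 2 * energy J β φ + 2 * energy J β ψ := by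
  have := dirichletForm_parallelogram J (height φ) (height ψ)
  unfold energy
  rw [height_add, height_sub, ← mul_add, this]
  ring

theorem weight_eq (J : Finset Site) (β : ℝ) (φ : PinnedField n) :
    weight J β n φ = Real.exp (-energy J β φ) := by
  unfold weight energy
  rw [neg_mul]

theorem partitionFunction_eq (J : Finset Site) (β : ℝ) :
    partitionFunction J β n = theta (energy (n := n) J β) 0 := by
  simp [partitionFunction, theta, weight_eq]

/-- The Poincaré constant may depend on `n`: only finiteness matters, because this sum does not
enter the bound of `theta_le`. -/
theorem tsum_exp_neg_half_energy_ne_top {J : Finset Site} (hJ : IsStepDistribution J) {β : ℝ}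
    (hβ : 0 < β) :
    ∑' φ : PinnedField n, ENNReal.ofReal (Real.exp (-(energy J β φ / 2))) ≠ ∞ := by
  obtain ⟨C, hC, hC'⟩ := exists_sum_sq_le_dirichletForm hJ n
  set c : ℝ := (2 * Real.pi) ^ 2 / (4 * β * C) with hc
  have hπ := Real.pi_pos
  have hc0 : 0 < c := by positivity
  refine ne_top_of_le_ne_top (tsum_pi_exp_neg_sum_sq_ne_top (ι := Torus n) hc0) ?_
  refine le_trans (ENNReal.tsum_le_tsum fun φ => ENNReal.ofReal_le_ofReal
    (Real.exp_le_exp.2 (neg_le_neg ?_)))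
    (ENNReal.tsum_comp_le_tsum_of_injective (f := fun φ : PinnedField n => φ.1)
      Subtype.val_injective
      fun f : Torus n → ℤ => ENNReal.ofReal (Real.exp (-(c * ∑ i, (f i : ℝ) ^ 2))))
  have h1 := hC' (height φ) (by simp [height, φ.2])
  have h2 : ∑ x, height φ x ^ 2 = (2 * Real.pi) ^ 2 * ∑ x, (φ.1 x : ℝ) ^ 2 := by
    rw [Finset.mul_sum]
    exact Finset.sum_congr rfl fun x _ => by rw [height, mul_pow]
  rw [h2] at h1
  unfold energy
  calc c * ∑ x, (φ.1 x : ℝ) ^ 2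
      = 1 / (4 * β * C) * ((2 * Real.pi) ^ 2 * ∑ x, (φ.1 x : ℝ) ^ 2) := by rw [hc]; ring
    _ ≤ 1 / (4 * β * C) * (C * dirichletForm J n (height φ)) := by gcongr
    _ = _ := by field_simp; ring

theorem lintegral_torusState (J : Finset Site) (β : ℝ) {f : EdgeField → ℝ≥0∞}
    (hf : Measurable f) :
    ∫⁻ η, f η ∂(torusState J β n) = (partitionFunction J β n)⁻¹ *
      ∑' φ : PinnedField n, ENNReal.ofReal (weight J β n φ) *
        f (gradient fun x => height φ (toTorus n x)) := by
  unfold torusState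
  rw [lintegral_smul_measure, lintegral_sum_measure, smul_eq_mul]
  congr 1
  refine tsum_congr fun φ => ?_
  rw [lintegral_smul_measure, lintegral_dirac' _ hf, smul_eq_mul]

/-- Second moments under the torus state of linear observables dominated by the energy. -/
theorem lintegral_torusState_sq_le {J : Finset Site} (hJ : IsStepDistribution J) {β : ℝ}
    (hβ : 0 < β) {f : EdgeField → ℝ} (hf : Measurable f) {D : ℝ} (hD : 0 < D)
    (l : PinnedField n →+ ℝ)
    (hl : ∀ φ, f (gradient fun x => height φ (toTorus n x)) = l φ)
    (hlD : ∀ φ, l φ ^ 2 ≤ D * dirichletForm J n (height φ)) :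
    ∫⁻ η, ENNReal.ofReal (f η ^ 2) ∂(torusState J β n) ≤
      ENNReal.ofReal (8 * Real.exp (1 / 2) * β * D) := by
  rw [lintegral_torusState J β (hf.pow_const 2).ennreal_ofReal]
  have h := tsum_sq_mul_exp_le (Q := energy (n := n) J β) injective_add_self_pinnedField
    (energy_parallelogram J β) (tsum_exp_neg_half_energy_ne_top hJ hβ) (D := 2 * β * D)
    (by positivity) l fun φ => by
      refine (hlD φ).trans_eq ?_
      unfold energy
      field_simp
  simp_rw [hl, weight_eq]
  calc _ ≤ (partitionFunction J β n)⁻¹ *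
        (ENNReal.ofReal (4 * Real.exp (1 / 2) * (2 * β * D)) * partitionFunction J β n) := by
        rw [partitionFunction_eq]
        gcongr
    _ = ENNReal.ofReal (8 * Real.exp (1 / 2) * β * D) *
        ((partitionFunction J β n)⁻¹ * partitionFunction J β n) := by
        rw [show 4 * Real.exp (1 / 2) * (2 * β * D) = 8 * Real.exp (1 / 2) * β * D by ring]
        ring
    -- An inequality suffices, so the partition function need not be shown nonzero or finite here.
    _ ≤ _ := mul_le_of_le_one_right' (ENNReal.inv_mul_le_one _)

end TorusModel

/-! ### Box sums of gradients. -/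

section BoxSums

/-- The point of the lattice box `[0, m)²` with given coordinates. -/
def boxPoint {m : ℕ} (a : Fin m × Fin m) : Site := ((a.1.1 : ℤ), (a.2.1 : ℤ))

/-- The sum of an edge field over the translates of an edge by the box `[0, m)²`. -/
def boxSum (m : ℕ) (e : Edge) (η : EdgeField) : ℝ :=
  ∑ a : Fin m × Fin m, η (e.translate (boxPoint a))

theorem continuous_boxSum (m : ℕ) (e : Edge) : Continuous (boxSum m e) := by
  unfold boxSum
  fun_prop

theorem boxSum_add (m : ℕ) (e : Edge) (η ζ : EdgeField) :
    boxSum m e (η + ζ) = boxSum m e η + boxSum m e ζ := by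
  simp [boxSum, Finset.sum_add_distrib]

/-- A box no larger than the torus does not wrap around, so each increment is counted at most once
in the energy. -/
theorem injective_toTorus_add_boxPoint {m n : ℕ} (hmn : m ≤ n) (q : Site) :
    Function.Injective fun a : Fin m × Fin m => toTorus n (q + boxPoint a) := by
  intro a b h
  have h' : toTorus n (boxPoint a) = toTorus n (boxPoint b) := by
    simpa [toTorus_add] using h
  have key : ∀ i j : Fin m, (((i.1 : ℤ) : ZMod n)) = ((j.1 : ℤ) : ZMod n) → i = j := by
    intro i j hij
    rw [Int.cast_natCast, Int.cast_natCast, ZMod.natCast_eq_natCast_iff',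
      Nat.mod_eq_of_lt (i.2.trans_le hmn), Nat.mod_eq_of_lt (j.2.trans_le hmn)] at hij
    exact Fin.ext hij
  exact Prod.ext (key _ _ (congrArg Prod.fst h')) (key _ _ (congrArg Prod.snd h'))

/-- Cauchy–Schwarz over the `m ^ 2` terms, whose squares form part of the increment energy. -/
theorem sq_boxSum_gradient_le {m n : ℕ} [NeZero n] (hmn : m ≤ n) (e : Edge) (h : Torus n → ℝ) :
    boxSum m e (gradient fun x => h (toTorus n x)) ^ 2 ≤
      (m : ℝ) ^ 2 * incrementEnergy n (e.1.1 - e.1.2) h := by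
  have h1 : boxSum m e (gradient fun x => h (toTorus n x)) =
      ∑ a : Fin m × Fin m, (h (toTorus n (e.1.2 + boxPoint a) + toTorus n (e.1.1 - e.1.2)) -
        h (toTorus n (e.1.2 + boxPoint a))) := by
    refine Finset.sum_congr rfl fun a _ => ?_
    have : e.1.1 + boxPoint a = e.1.2 + boxPoint a + (e.1.1 - e.1.2) := by abel
    rw [← toTorus_add, ← this]
    rfl
  rw [h1]
  refine sq_sum_le_card_mul_sum_sq.trans ?_
  have h2 : (((Finset.univ : Finset (Fin m × Fin m)).card : ℕ) : ℝ) = (m : ℝ) ^ 2 := by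
    simp [pow_two]
  rw [h2]
  refine mul_le_mul_of_nonneg_left ?_ (by positivity)
  rw [← Finset.sum_image (s := Finset.univ) (g := fun a => toTorus n (e.1.2 + boxPoint a))
    (f := fun x => (h (x + toTorus n (e.1.1 - e.1.2)) - h x) ^ 2)
    (injective_toTorus_add_boxPoint hmn _).injOn]
  exact Finset.sum_le_sum_of_subset_of_nonneg (Finset.subset_univ _) fun _ _ _ => sq_nonneg _

/-- The variance of box sums of gradients grows at most like the volume of the box, uniformly
in the torus. -/
theorem exists_lintegral_torusState_boxSum_le {J : Finset Site} (hJ : IsStepDistribution J)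
    {β : ℝ} (hβ : 0 < β) (e : Edge) :
    ∃ C : ℝ, 0 < C ∧ ∀ (m n : ℕ) [NeZero n], 0 < m → m ≤ n →
      ∫⁻ η, ENNReal.ofReal (boxSum m e η ^ 2) ∂(torusState J β n) ≤
        ENNReal.ofReal (C * (m : ℝ) ^ 2) := by
  obtain ⟨C, hC, hC'⟩ := exists_incrementEnergy_le hJ (e.1.1 - e.1.2)
  refine ⟨8 * Real.exp (1 / 2) * β * C, by positivity, fun m n _ hm hmn => ?_⟩
  have h := lintegral_torusState_sq_le (n := n) hJ hβ (continuous_boxSum m e).measurable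
    (D := (m : ℝ) ^ 2 * C) (by positivity)
    (AddMonoidHom.mk'
      (fun φ : PinnedField n => boxSum m e (gradient fun x => height φ (toTorus n x)))
      fun φ ψ => by
        rw [← boxSum_add]
        congr 1
        funext f
        simp only [gradient, height_add, Pi.add_apply]
        ring)
    (fun φ => rfl) fun φ => by
      rw [mul_assoc]
      exact (sq_boxSum_gradient_le hmn e (height φ)).trans
        (mul_le_mul_of_nonneg_left (hC' n _) (by positivity))
  refine h.trans_eq ?_
  congr 1
  ring

end BoxSums

/-! ### Passage to the weak limit and to ergodic components. -/

section Limits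

/-- Second moment bounds for continuous observables pass to the weak limit. -/
theorem IsTorusLimit.lintegral_sq_le {J : Finset Site} {β : ℝ} {M : ℕ → ℕ}
    [∀ k, NeZero (M k)] {μ : Measure EdgeField} (hμ : IsTorusLimit J β M μ)
    {f : EdgeField → ℝ} (hf : Continuous f) {B : ℝ} (hB : 0 ≤ B)
    (hfB : ∀ᶠ k in atTop,
      ∫⁻ η, ENNReal.ofReal (f η ^ 2) ∂(torusState J β (M k)) ≤ ENNReal.ofReal B) :
    ∫⁻ η, ENNReal.ofReal (f η ^ 2) ∂μ ≤ ENNReal.ofReal B := by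
  have := hμ.1
  have hpos : ∀ (K : ℕ) (η : EdgeField), 0 ≤ min (f η ^ 2) (K : ℝ) := fun K η =>
    le_min (sq_nonneg _) (Nat.cast_nonneg K)
  have hcont : ∀ K : ℕ, Continuous fun η : EdgeField => min (f η ^ 2) (K : ℝ) := fun K =>
    (hf.pow 2).min continuous_const
  have hbdd : ∀ (K : ℕ) (η : EdgeField), ‖min (f η ^ 2) (K : ℝ)‖ ≤ K := fun K η => by
    rw [Real.norm_of_nonneg (hpos K η)]
    exact min_le_right _ _
  -- Weak convergence only tests bounded functions, so `f ^ 2` is truncated at `K` and recovered by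
  -- monotone convergence.
  have htrunc : ∀ K : ℕ,
      ∫⁻ η, ENNReal.ofReal (min (f η ^ 2) (K : ℝ)) ∂μ ≤ ENNReal.ofReal B := by
    intro K
    have hlim := hμ.2 (BoundedContinuousFunction.ofNormedAddCommGroup _ (hcont K) K (hbdd K))
    simp only [BoundedContinuousFunction.coe_ofNormedAddCommGroup] at hlim
    have hle : ∫ η, min (f η ^ 2) (K : ℝ) ∂μ ≤ B := by
      refine le_of_tendsto hlim ?_
      filter_upwards [hfB] with k hk
      rw [integral_eq_lintegral_of_nonneg_ae (Eventually.of_forall (hpos K))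
        (hcont K).aestronglyMeasurable]
      refine ENNReal.toReal_le_of_le_ofReal hB (le_trans (lintegral_mono fun η => ?_) hk)
      exact ENNReal.ofReal_le_ofReal (min_le_left _ _)
    have hint : Integrable (fun η => min (f η ^ 2) (K : ℝ)) μ :=
      Integrable.of_bound (hcont K).aestronglyMeasurable K (Eventually.of_forall (hbdd K))
    rw [← ofReal_integral_eq_lintegral_ofReal hint (Eventually.of_forall (hpos K))]
    exact ENNReal.ofReal_le_ofReal hle
  calc ∫⁻ η, ENNReal.ofReal (f η ^ 2) ∂μ
      ≤ ∫⁻ η, ⨆ K : ℕ, ENNReal.ofReal (min (f η ^ 2) (K : ℝ)) ∂μ := by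
        refine lintegral_mono fun η => ?_
        obtain ⟨K, hK⟩ := exists_nat_ge (f η ^ 2)
        refine le_iSup_of_le K ?_
        rw [min_eq_left hK]
    _ = ⨆ K : ℕ, ∫⁻ η, ENNReal.ofReal (min (f η ^ 2) (K : ℝ)) ∂μ :=
        lintegral_iSup (fun K => (hcont K).measurable.ennreal_ofReal) fun K K' hKK' η =>
          ENNReal.ofReal_le_ofReal (min_le_min_left _ (Nat.cast_le.2 hKK'))
    _ ≤ _ := iSup_le htrunc

theorem IsErgodicDecomposition.lintegral_eq {ρ : Measure (Measure EdgeField)}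
    {μ : Measure EdgeField} (hρ : IsErgodicDecomposition ρ μ) {f : EdgeField → ℝ≥0∞}
    (hf : Measurable f) : ∫⁻ η, f η ∂μ = ∫⁻ ν, ∫⁻ η, f η ∂ν ∂ρ := by
  have : μ = Measure.join ρ := Measure.ext fun A hA => by
    rw [Measure.join_apply hA, hρ.barycentre A hA]
  rw [this, Measure.lintegral_join hf.aemeasurable]

/-- The mean gradient of an invariant measure is controlled by its box sums. -/
theorem IsErgodicMeasure.sq_integral_le {ν : Measure EdgeField} (hν : IsErgodicMeasure ν)
    {e : Edge} (hint : Integrable (fun η : EdgeField => η e) ν) (m : ℕ) :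
    ENNReal.ofReal ((m : ℝ) ^ 4) * ENNReal.ofReal ((∫ η, η e ∂ν) ^ 2) ≤
      ∫⁻ η, ENNReal.ofReal (boxSum m e η ^ 2) ∂ν := by
  have := hν.isProbabilityMeasure
  have htr : ∀ a : Site, Integrable (fun η : EdgeField => η (e.translate a)) ν ∧
      ∫ η, η (e.translate a) ∂ν = ∫ η, η e ∂ν := by
    intro a
    have hmap := (hν.invariant a).map_eq
    have hmeas := (hν.invariant a).measurable
    refine ⟨(hν.invariant a).integrable_comp_of_integrable hint, ?_⟩
    conv_rhs => rw [← hmap]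
    rw [integral_map hmeas.aemeasurable (measurable_pi_apply e).aestronglyMeasurable]
    rfl
  have hS : ∫ η, boxSum m e η ∂ν = (m : ℝ) ^ 2 * ∫ η, η e ∂ν := by
    unfold boxSum
    rw [integral_finsetSum _ fun a _ => (htr _).1]
    simp [(htr _).2, pow_two]
  by_cases hfin : ∫⁻ η, ENNReal.ofReal (boxSum m e η ^ 2) ∂ν = ∞
  · rw [hfin]; exact le_top
  have hmeas : AEStronglyMeasurable (boxSum m e) ν :=
    (continuous_boxSum m e).measurable.aestronglyMeasurable
  have hL2 : Integrable (fun η => boxSum m e η ^ 2) ν := by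
    refine ⟨hmeas.pow 2, ?_⟩
    rw [hasFiniteIntegral_iff_ofReal (Eventually.of_forall fun _ => sq_nonneg _)]
    exact lt_top_iff_ne_top.2 hfin
  -- Nonnegative variance is Jensen's inequality for the box sum, whose mean is `m ^ 2` times the
  -- tilt by invariance.
  have hvar := ProbabilityTheory.variance_nonneg (boxSum m e) ν
  rw [ProbabilityTheory.variance_eq_sub ((memLp_two_iff_integrable_sq hmeas).2 hL2), hS] at hvar
  rw [← ENNReal.ofReal_mul (by positivity), ← ofReal_integral_eq_lintegral_ofReal hL2
    (Eventually.of_forall fun _ => sq_nonneg _)]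
  refine ENNReal.ofReal_le_ofReal ?_
  have h2 : ∫ η, (boxSum m e ^ 2) η ∂ν = ∫ η, boxSum m e η ^ 2 ∂ν := rfl
  rw [h2] at hvar
  nlinarith

end Limits

/-! ### Vanishing of the tilt. -/

section Tilt

variable {ρ : Measure (Measure EdgeField)} {μ : Measure EdgeField} {e : Edge} {C : ℝ}

/-- A box of side one is the edge itself, and a finite second moment under `μ` is inherited by
almost every component. -/
theorem IsErgodicDecomposition.ae_integrable (hρ : IsErgodicDecomposition ρ μ)
    (hC : ∫⁻ η, ENNReal.ofReal (boxSum 1 e η ^ 2) ∂μ ≤ ENNReal.ofReal C) :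
    ∀ᵐ ν ∂ρ, Integrable (fun η : EdgeField => η e) ν := by
  have hS : ∀ η : EdgeField, boxSum 1 e η = η e := by
    intro η
    have : e.translate (boxPoint ((0, 0) : Fin 1 × Fin 1)) = e := by
      apply Subtype.ext
      simp [Edge.translate, boxPoint, ← Prod.zero_eq_mk]
    rw [boxSum, Fintype.sum_subsingleton _ ((0, 0) : Fin 1 × Fin 1)]
    exact congrArg η this
  simp_rw [hS] at hC
  have hmeas : Measurable fun η : EdgeField => ENNReal.ofReal (η e ^ 2) :=
    ((measurable_pi_apply e).pow_const 2).ennreal_ofReal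
  rw [hρ.lintegral_eq hmeas] at hC
  filter_upwards [hρ.ergodic, ae_lt_top (Measure.measurable_lintegral hmeas)
    (ne_top_of_le_ne_top ENNReal.ofReal_ne_top hC)] with ν hν hfin
  have := hν.isProbabilityMeasure
  have hm : AEStronglyMeasurable (fun η : EdgeField => η e) ν :=
    (measurable_pi_apply e).aestronglyMeasurable
  refine MemLp.integrable one_le_two ((memLp_two_iff_integrable_sq hm).2 ⟨hm.pow 2, ?_⟩)
  rwa [hasFiniteIntegral_iff_ofReal (Eventually.of_forall fun _ => sq_nonneg _)]

theorem IsErgodicDecomposition.ae_integral_eq_zero (hρ : IsErgodicDecomposition ρ μ)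
    (hC : ∀ m : ℕ, 0 < m →
      ∫⁻ η, ENNReal.ofReal (boxSum m e η ^ 2) ∂μ ≤ ENNReal.ofReal (C * (m : ℝ) ^ 2)) :
    ∀ᵐ ν ∂ρ, Integrable (fun η : EdgeField => η e) ν ∧ ∫ η, η e ∂ν = 0 := by
  have hmeas : ∀ m : ℕ, Measurable fun η : EdgeField => ENNReal.ofReal (boxSum m e η ^ 2) :=
    fun m => ((continuous_boxSum m e).measurable.pow_const 2).ennreal_ofReal
  -- `G` dominates the squared tilt and is measurable as a countable infimum, so measurability of
  -- the tilt in `ν` is never needed. The side `m + 1` keeps the normalization away from zero.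
  set G : Measure EdgeField → ℝ≥0∞ := fun ν => ⨅ m : ℕ,
    ENNReal.ofReal (((m + 1 : ℕ) : ℝ) ^ 4)⁻¹ *
      ∫⁻ η, ENNReal.ofReal (boxSum (m + 1) e η ^ 2) ∂ν with hG
  have hGm : Measurable G := Measurable.iInf fun m =>
    (Measure.measurable_lintegral (hmeas (m + 1))).const_mul _
  have hGle : ∀ m : ℕ, ∫⁻ ν, G ν ∂ρ ≤ ENNReal.ofReal (C * (((m + 1 : ℕ) : ℝ) ^ 2)⁻¹) := by
    intro m
    calc ∫⁻ ν, G ν ∂ρ ≤ ∫⁻ ν, ENNReal.ofReal (((m + 1 : ℕ) : ℝ) ^ 4)⁻¹ *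
          ∫⁻ η, ENNReal.ofReal (boxSum (m + 1) e η ^ 2) ∂ν ∂ρ :=
          lintegral_mono fun ν => iInf_le _ m
      _ = ENNReal.ofReal (((m + 1 : ℕ) : ℝ) ^ 4)⁻¹ *
          ∫⁻ η, ENNReal.ofReal (boxSum (m + 1) e η ^ 2) ∂μ := by
          rw [lintegral_const_mul _ (Measure.measurable_lintegral (hmeas (m + 1))),
            ← hρ.lintegral_eq (hmeas (m + 1))]
      _ ≤ ENNReal.ofReal (((m + 1 : ℕ) : ℝ) ^ 4)⁻¹ *
          ENNReal.ofReal (C * ((m + 1 : ℕ) : ℝ) ^ 2) := by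
          gcongr
          exact hC (m + 1) m.succ_pos
      _ = _ := by
          rw [← ENNReal.ofReal_mul (by positivity)]
          congr 1
          field_simp
  have hG0 : ∫⁻ ν, G ν ∂ρ = 0 := by
    refine le_antisymm (ge_of_tendsto' (x := atTop) ?_ hGle) zero_le
    have h1 : Tendsto (fun m : ℕ => C * (((m + 1 : ℕ) : ℝ) ^ 2)⁻¹) atTop (𝓝 (C * 0)) :=
      (((tendsto_pow_atTop two_ne_zero).comp
        ((tendsto_natCast_atTop_atTop (R := ℝ)).comp
          (tendsto_add_atTop_nat 1))).inv_tendsto_atTop).const_mul C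
    simpa using ENNReal.tendsto_ofReal h1
  rw [lintegral_eq_zero_iff hGm] at hG0
  filter_upwards [hρ.ergodic, hρ.ae_integrable (C := C) (by simpa using hC 1 one_pos), hG0]
    with ν hν hint hGν
  refine ⟨hint, ?_⟩
  have hle : ENNReal.ofReal ((∫ η, η e ∂ν) ^ 2) ≤ G ν := by
    refine le_iInf fun m => ?_
    have h := hν.sq_integral_le hint (m + 1)
    have hpos : (0 : ℝ) < ((m + 1 : ℕ) : ℝ) ^ 4 := by positivity
    calc ENNReal.ofReal ((∫ η, η e ∂ν) ^ 2)
        = ENNReal.ofReal (((m + 1 : ℕ) : ℝ) ^ 4)⁻¹ * (ENNReal.ofReal (((m + 1 : ℕ) : ℝ) ^ 4) *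
            ENNReal.ofReal ((∫ η, η e ∂ν) ^ 2)) := by
          rw [← mul_assoc, ← ENNReal.ofReal_mul (by positivity), inv_mul_cancel₀ hpos.ne',
            ENNReal.ofReal_one, one_mul]
      _ ≤ _ := by gcongr
  rw [hGν, Pi.zero_apply, nonpos_iff_eq_zero, ENNReal.ofReal_eq_zero] at hle
  exact pow_eq_zero_iff two_ne_zero |>.1 (le_antisymm hle (sq_nonneg _))

end Tilt

end DiscreteGaussian

theorem propositionA2
    (J : Finset DiscreteGaussian.Site) (hJ : DiscreteGaussian.IsStepDistribution J)
    (β : ℝ) (hβ : 0 < β)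
    (M : ℕ → ℕ) [∀ k, NeZero (M k)] (hM : Tendsto M atTop atTop)
    (μ : Measure DiscreteGaussian.EdgeField)
    (hμ : DiscreteGaussian.IsTorusLimit J β M μ)
    (ρ : Measure (Measure DiscreteGaussian.EdgeField))
    (hρ : DiscreteGaussian.IsErgodicDecomposition ρ μ) :
    ∀ᵐ ν ∂ρ, ∀ e : DiscreteGaussian.Edge,
      Integrable (fun η : DiscreteGaussian.EdgeField => η e) ν ∧
        ∫ η : DiscreteGaussian.EdgeField, η e ∂ν = 0 := by
  rw [ae_all_iff]
  intro e
  obtain ⟨C, hC, hC'⟩ := DiscreteGaussian.exists_lintegral_torusState_boxSum_le hJ hβ e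
  refine hρ.ae_integral_eq_zero (C := C) fun m hm =>
    hμ.lintegral_sq_le (DiscreteGaussian.continuous_boxSum m e) (by positivity) ?_
  -- For fixed `m`, all but finitely many tori contain the box.
  filter_upwards [hM.eventually_ge_atTop m] with k hk
  exact hC' m (M k) hm hk
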